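/- Let $\mathbb S^1\subset\mathbb R^2$ be the unit circle with angular coordinate $\theta$, let $R(x)=-x$ be the antipodal map, and let $\delta>0$. For finite nonnegative Borel measures $\rho_0,\rho_1$ on $\mathbb S^1$, let $\mathcal{CE}(\rho_0,\rho_1)$ be the set of triples $\mu=(\rho,\omega,\zeta)$ consisting of a finite nonnegative Borel measure $\rho$ and two finite signed Borel measures $\omega,\zeta$ on $[0,1]\times\mathbb S^1$ such that for all $\phi\in C^1([0,1]\times\mathbb S^1)$ $$\int \partial_t\phi\,d\rho+\int\partial_\theta\phi\,d\omega+\int\phi\,d\zeta=\int_{\mathbb S^1}\phi(1,\cdot)\,d\rho_1-\int_{\mathbb S^1}\phi(0,\cdot)\,d\rho_0 .$$ Let $f_\delta(r,w,z)=\frac{w^2+\delta^2z^2}{2r}$ if $r>0$, $f_\delta(0,0,0)=0$, and $f_\delta=+\infty$ otherwise. The unconstrained Wasserstein--Fisher--Rao (WFR) problem between $\rho_0$ and $\rho_1$ is to minimize $\int_{[0,1]\times\mathbb S^1} f_\delta\bigl(\tfrac{d\mu}{d\lambda}\bigr)\,d\lambda$ over $\mu\in\mathcal{CE}(\rho_0,\rho_1)$,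 where $\lambda$ is any nonnegative $\sigma$-finite measure with $\rho,\omega,\zeta\ll\lambda$ (the value does not depend on $\lambda$). Suppose that $R_*\rho_0=\rho_0$ and $R_*\rho_1=\rho_1$. Then the unconstrained WFR problem between $\rho_0$ and $\rho_1$ has a minimizer $\mu=(\rho,\omega,\zeta)$ that disintegrates in time, $\rho=dt\otimes\rho_t$, $\omega=dt\otimes\omega_t$, $\zeta=dt\otimes\zeta_t$, and is symmetric at almost every time: $R_*\rho_t=\rho_t$, $R_*\omega_t=\omega_t$ and $R_*\zeta_t=\zeta_t$ for almost every $t\in[0,1]$. In particular, this minimizer satisfies the convex-curve constraint $\int_{\mathbb S^1}x\,d\rho_t(x)=0$ for almost every $t\in[0,1]$. -/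

import Mathlib

open MeasureTheory ProbabilityTheory Set
open scoped unitInterval ENNReal

noncomputable section

namespace WFR

/-- The circle carries its Borel σ-algebra. -/
instance : MeasurableSpace Circle := borel Circle

instance : BorelSpace Circle := ⟨rfl⟩

/-- A triple `(ρ, ω, ζ)` on `[0,1] × 𝕊¹`: a finite nonnegative Borel measure (density) and two
finite signed Borel measures (momentum and source). The tangent bundle of the unit circle is
trivialized by the unit field `∂_θ`, so that the momentum is a scalar signed measure. -/
structure Path where
  ρ : FiniteMeasure (I × Circle)
  ω : SignedMeasure (I × Circle)
  ζ : SignedMeasure (I × Circle)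

/-- `φ` is of class `C¹` on `ℝ × 𝕊¹`, expressed in the angular coordinate `x = exp(iθ)`. The
functions of class `C¹` on `[0,1] × 𝕊¹` are the restrictions of these. -/
def IsC1 (φ : ℝ × Circle → ℝ) : Prop :=
  ContDiff ℝ 1 fun p : ℝ × ℝ => φ (p.1, Circle.exp p.2)

/-- The time derivative `∂_t φ`. -/
def dt (φ : ℝ × Circle → ℝ) (p : ℝ × Circle) : ℝ :=
  deriv (fun s : ℝ => φ (s, p.2)) p.1

/-- The angular derivative `∂_θ φ`, i.e. the derivative along the circle at unit speed. -/
def dθ (φ : ℝ × Circle → ℝ) (p : ℝ × Circle) : ℝ :=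
  deriv (fun s : ℝ => φ (p.1, p.2 * Circle.exp s)) 0

/-- The set `𝒞ℰ(ρ₀, ρ₁)` of triples that satisfy the continuity equation
`∂_t ρ + ∂_θ ω = ζ` in the distributional sense, with boundary values `ρ₀` and `ρ₁`. -/
def CE (ρ₀ ρ₁ : Measure Circle) : Set Path :=
  {μ | ∀ φ : ℝ × Circle → ℝ, IsC1 φ →
    (∫ p : I × Circle, dt φ ((p.1 : ℝ), p.2) ∂(μ.ρ : Measure (I × Circle))) +
      (∫ᵛ p : I × Circle, dθ φ ((p.1 : ℝ), p.2) ∂•μ.ω) +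
      (∫ᵛ p : I × Circle, φ ((p.1 : ℝ), p.2) ∂•μ.ζ) =
    (∫ x, φ (1, x) ∂ρ₁) - ∫ x, φ (0, x) ∂ρ₀}

open Classical in
/-- The infinitesimal cost `f_δ(r, w, z)`. -/
def cost (δ r w z : ℝ) : ℝ≥0∞ :=
  if 0 < r then ENNReal.ofReal ((w ^ 2 + δ ^ 2 * z ^ 2) / (2 * r))
  else if r = 0 ∧ w = 0 ∧ z = 0 then 0
  else ∞

/-- The integral `∫ f_δ(dμ/dν) dν` over `[0,1] × 𝕊¹`. -/
def energyWrt (δ : ℝ) (μ : Path) (ν : Measure (I × Circle)) : ℝ≥0∞ :=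
  ∫⁻ p, cost δ ((μ.ρ : Measure (I × Circle)).rnDeriv ν p).toReal
    (μ.ω.rnDeriv ν p) (μ.ζ.rnDeriv ν p) ∂ν

/-- The reference measure `ρ + |ω| + |ζ|`, which dominates the three measures of the triple. -/
def Path.ref (μ : Path) : Measure (I × Circle) :=
  (μ.ρ : Measure (I × Circle)) + μ.ω.totalVariation + μ.ζ.totalVariation

/-- The Wasserstein-Fisher-Rao energy of a triple. The choice of the dominating measure does not
matter, see `energyWrt_eq_energy`. -/
def energy (δ : ℝ) (μ : Path) : ℝ≥0∞ := energyWrt δ μ μ.ref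

/-- The squared distance `WFR_δ(ρ₀, ρ₁)²`. -/
def wfrSq (δ : ℝ) (ρ₀ ρ₁ : Measure Circle) : ℝ≥0∞ := ⨅ μ ∈ CE ρ₀ ρ₁, energy δ μ

/-- `μ` is a minimizer of the unconstrained problem between `ρ₀` and `ρ₁`. -/
def IsMinimizer (δ : ℝ) (ρ₀ ρ₁ : Measure Circle) (μ : Path) : Prop :=
  μ ∈ CE ρ₀ ρ₁ ∧ energy δ μ = wfrSq δ ρ₀ ρ₁

/-- `ρ = dt ⊗ ρ_t` for a Borel family `t ↦ ρ_t` of finite measures on the circle. -/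
def Disintegrates (ρ : Measure (I × Circle)) (ρt : Kernel I Circle) : Prop :=
  IsSFiniteKernel ρt ∧ (∀ t, IsFiniteMeasure (ρt t)) ∧ ρ = (volume : Measure I) ⊗ₘ ρt

/-- `s = dt ⊗ s_t` for a Borel family `t ↦ s_t` of signed measures on the circle whose total
variation is integrable in time. -/
def SignedDisintegrates (s : SignedMeasure (I × Circle)) (st : I → SignedMeasure Circle) : Prop :=
  (∀ B, MeasurableSet B → Measurable fun t => st t B) ∧
    (∫⁻ t, (st t).totalVariation univ) < ∞ ∧
    ∀ (A : Set I) (B : Set Circle), MeasurableSet A → MeasurableSet B →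
      s (A ×ˢ B) = ∫ t in A, st t B

/-- The antipodal map `R(x) = -x` of the unit circle. -/
def antipode (x : Circle) : Circle := -x

lemma measurable_antipode : Measurable antipode :=
  (continuous_neg : Continuous fun x : Circle => -x).measurable

lemma cost_mul {c : ℝ} (hc : 0 ≤ c) (δ r w z : ℝ) :
    cost δ (r * c) (w * c) (z * c) = ENNReal.ofReal c * cost δ r w z := by
  rcases hc.eq_or_lt with rfl | hc
  · simp [cost]
  · unfold cost
    by_cases hr : 0 < r
    · rw [if_pos hr, if_pos (by positivity), ← ENNReal.ofReal_mul hc.le]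
      congr 1
      field_simp
    · rw [if_neg hr, if_neg (by rw [mul_pos_iff_of_pos_right hc]; exact hr)]
      by_cases h : r = 0 ∧ w = 0 ∧ z = 0
      · simp [h]
      · rw [if_neg h, if_neg (by simpa [hc.ne'] using h),
          ENNReal.mul_top (by simpa using hc)]

lemma measurable_cost (δ : ℝ) : Measurable fun p : ℝ × ℝ × ℝ => cost δ p.1 p.2.1 p.2.2 := by
  unfold cost
  refine Measurable.ite (measurableSet_lt measurable_const measurable_fst) (by fun_prop) ?_
  refine Measurable.ite ?_ measurable_const measurable_const
  have : {p : ℝ × ℝ × ℝ | p.1 = 0 ∧ p.2.1 = 0 ∧ p.2.2 = 0} = {(0, 0, 0)} := by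
    ext ⟨a, b, c⟩; simp
  rw [this]
  exact measurableSet_singleton _

instance (μ : Path) : IsFiniteMeasure μ.ref := by
  unfold Path.ref; infer_instance

/-- The value of the energy does not depend on the dominating measure. -/
lemma energyWrt_eq_energy (δ : ℝ) (μ : Path) (ν : Measure (I × Circle)) [SigmaFinite ν]
    (hρ : (μ.ρ : Measure (I × Circle)) ≪ ν) (hω : μ.ω.totalVariation ≪ ν)
    (hζ : μ.ζ.totalVariation ≪ ν) : energyWrt δ μ ν = energy δ μ := by
  have href : μ.ref ≪ ν := (hρ.add_left hω).add_left hζ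
  have key : ∀ m : Measure (I × Circle), IsFiniteMeasure m → m ≤ μ.ref →
      ∀ᵐ p ∂ν, (m.rnDeriv ν p).toReal =
        (m.rnDeriv μ.ref p).toReal * (μ.ref.rnDeriv ν p).toReal := by
    intro m _ hm
    filter_upwards [Measure.rnDeriv_mul_rnDeriv (κ := ν) hm.absolutelyContinuous] with p hp
    rw [← hp, Pi.mul_apply, ENNReal.toReal_mul]
  have le1 : (μ.ρ : Measure (I × Circle)) ≤ μ.ref :=
    (Measure.le_add_right le_rfl).trans (Measure.le_add_right le_rfl)
  have le2 : μ.ω.totalVariation ≤ μ.ref :=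
    (Measure.le_add_left le_rfl).trans (Measure.le_add_right le_rfl)
  have le3 : μ.ζ.totalVariation ≤ μ.ref := Measure.le_add_left le_rfl
  have pos_le : ∀ s : SignedMeasure (I × Circle),
      s.toJordanDecomposition.posPart ≤ s.totalVariation := fun s => Measure.le_add_right le_rfl
  have neg_le : ∀ s : SignedMeasure (I × Circle),
      s.toJordanDecomposition.negPart ≤ s.totalVariation := fun s => Measure.le_add_left le_rfl
  have hmeas : Measurable fun p => cost δ ((μ.ρ : Measure (I × Circle)).rnDeriv μ.ref p).toReal
      (μ.ω.rnDeriv μ.ref p) (μ.ζ.rnDeriv μ.ref p) :=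
    (measurable_cost δ).comp ((Measure.measurable_rnDeriv _ _).ennreal_toReal.prodMk
      ((SignedMeasure.measurable_rnDeriv _ _).prodMk (SignedMeasure.measurable_rnDeriv _ _)))
  unfold energy energyWrt
  rw [← lintegral_rnDeriv_mul href hmeas.aemeasurable]
  refine lintegral_congr_ae ?_
  filter_upwards [key _ inferInstance le1, key _ inferInstance ((pos_le _).trans le2),
    key _ inferInstance ((neg_le _).trans le2), key _ inferInstance ((pos_le _).trans le3),
    key _ inferInstance ((neg_le _).trans le3), Measure.rnDeriv_ne_top μ.ref ν]
    with p h1 h2 h3 h4 h5 h6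
  simp only [SignedMeasure.rnDeriv_def]
  rw [h1, h2, h3, h4, h5, ← sub_mul, ← sub_mul, cost_mul ENNReal.toReal_nonneg,
    ENNReal.ofReal_toReal h6]

end WFR

end

noncomputable section

namespace WFR

/-! The energy is convex and the reflection preserves both it and the continuity equation with
symmetric boundary data, so averaging a minimizer with its reflection costs nothing. Existence and
symmetry are both obtained in a dual formulation, `IsAdmissible`: a triple becomes three linear
functionals `R`, `W`, `Z` on `C([0,1] × 𝕊¹)`, and "energy at most `E`" becomes the family of Young
inequalities `W b + Z c ≤ E + R (b² + c²/δ²) / 2`, the Legendre dual of `f_δ`. These conditions are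
affine in `(R, W, Z, E)`, hence stable under averages (`half_add`) and pointwise limits
(`exists_admissible_of_tendsto`).

Compactness needs a mass bound, which comes from testing with `φ = t` (`mass_le`); Young then bounds
`W` and `Z`. Hence a least `E` exists, and every triple of finite energy is admissible at its own
energy (`exists_admissible_of_mem_CE`), so this `E` bounds the problem from below.

Conversely, Riesz-Markov turns `R` into a measure `ρ`, and Riesz representation in `L²(ρ)` gives `W`
and `Z` densities with energy at most `E` (`exists_densities`). Testing with primitives of functions
of time shows that the time marginal of `ρ` is absolutely continuous, whence the disintegration.
Invariance holds a priori only almost everywhere; averaging the kernel and the densities with their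
reflections makes it hold at every time. -/

lemma isOpenQuotientMap_circleExp : IsOpenQuotientMap Circle.exp :=
  ⟨Circle.exp_surjective, Circle.exp.continuous, isLocalHomeomorph_circleExp.isOpenMap⟩

/-- A function on `ℝ × 𝕊¹` is continuous when it is so in the angular coordinate. -/
lemma continuous_of_angular {G : ℝ × Circle → ℝ}
    (h : Continuous fun p : ℝ × ℝ => G (p.1, Circle.exp p.2)) : Continuous G :=
  ((IsOpenQuotientMap.id (X := ℝ)).prodMap
    isOpenQuotientMap_circleExp).isQuotientMap.continuous_iff.2 h

variable {φ : ℝ × Circle → ℝ}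

lemma IsC1.hasDerivAt_dt (hφ : IsC1 φ) (t θ : ℝ) :
    HasDerivAt (fun s => φ (s, Circle.exp θ))
      (fderiv ℝ (fun p : ℝ × ℝ => φ (p.1, Circle.exp p.2)) (t, θ) (1, 0)) t :=
  ((hφ.differentiable one_ne_zero (t, θ)).hasFDerivAt.comp_hasDerivAt t
    ((hasDerivAt_id t).prodMk (hasDerivAt_const t θ)) :)

lemma IsC1.hasDerivAt_dθ (hφ : IsC1 φ) (t θ : ℝ) :
    HasDerivAt (fun s => φ (t, Circle.exp θ * Circle.exp s))
      (fderiv ℝ (fun p : ℝ × ℝ => φ (p.1, Circle.exp p.2)) (t, θ) (0, 1)) 0 := by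
  have h : HasDerivAt (fun s : ℝ => (t, θ + s)) ((0 : ℝ), (1 : ℝ)) 0 :=
    (hasDerivAt_const _ t).prodMk ((hasDerivAt_id (0 : ℝ)).const_add θ)
  have h' := (hφ.differentiable one_ne_zero (t, θ + 0)).hasFDerivAt.comp_hasDerivAt 0 h
  simpa [Function.comp_def, Circle.exp_add] using h'

lemma IsC1.continuous (hφ : IsC1 φ) : Continuous φ :=
  continuous_of_angular (ContDiff.continuous hφ)

lemma IsC1.continuous_dt (hφ : IsC1 φ) : Continuous (dt φ) := by
  refine continuous_of_angular ?_
  have h := (hφ.continuous_fderiv one_ne_zero).clm_apply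
    (continuous_const (y := ((1 : ℝ), (0 : ℝ))))
  exact h.congr fun p => (hφ.hasDerivAt_dt p.1 p.2).deriv.symm

lemma IsC1.continuous_dθ (hφ : IsC1 φ) : Continuous (dθ φ) := by
  refine continuous_of_angular ?_
  have h := (hφ.continuous_fderiv one_ne_zero).clm_apply
    (continuous_const (y := ((0 : ℝ), (1 : ℝ))))
  exact h.congr fun p => (hφ.hasDerivAt_dθ p.1 p.2).deriv.symm

/-- The restriction of a continuous function on `ℝ × 𝕊¹` to `[0,1] × 𝕊¹`. -/
def restrictTime (φ : ℝ × Circle → ℝ) (hφ : Continuous φ) : C(I × Circle, ℝ) :=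
  ⟨fun p => φ ((p.1 : ℝ), p.2), by fun_prop⟩

@[simp] lemma restrictTime_apply (hφ : Continuous φ) (p : I × Circle) :
    restrictTime φ hφ p = φ ((p.1 : ℝ), p.2) := rfl

lemma neg_circleExp (θ : ℝ) : -Circle.exp θ = Circle.exp (θ + Real.pi) := by
  ext; simp [Circle.exp_add]

lemma isC1_comp_antipode (hφ : IsC1 φ) : IsC1 fun p => φ (p.1, antipode p.2) := by
  have h : ContDiff ℝ 1 fun p : ℝ × ℝ => (p.1, p.2 + Real.pi) := by fun_prop
  have := ContDiff.comp (f := fun p : ℝ × ℝ => (p.1, p.2 + Real.pi)) hφ h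
  simpa [IsC1, Function.comp_def, antipode, neg_circleExp] using this

lemma dθ_comp_antipode (φ : ℝ × Circle → ℝ) (p : ℝ × Circle) :
    dθ (fun p => φ (p.1, antipode p.2)) p = dθ φ (p.1, antipode p.2) := by
  simp [dθ, antipode, neg_mul]

/-- The map `(t, x) ↦ (t, -x)` of `[0,1] × 𝕊¹`. -/
def flip : C(I × Circle, I × Circle) :=
  ⟨fun p => (p.1, antipode p.2), by unfold antipode; fun_prop⟩

@[simp] lemma flip_apply (p : I × Circle) : flip p = (p.1, antipode p.2) := rfl

@[simp] lemma antipode_antipode (x : Circle) : antipode (antipode x) = x := neg_neg x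

/-- Functions of time alone. -/
lemma isC1_of_time {u : ℝ → ℝ} (hu : ContDiff ℝ 1 u) : IsC1 fun p => u p.1 :=
  hu.comp contDiff_fst

lemma dθ_of_time (u : ℝ → ℝ) (p : ℝ × Circle) : dθ (fun p => u p.1) p = 0 := by simp [dθ]

/-! ### Densities: integration, Riesz representation, duality for the energy -/

section General

variable {X : Type*} [MeasurableSpace X]

/-- Multiplication of reals commutes; this puts the pairing in the form that
`VectorMeasure.integral_toSignedMeasure` rewrites. -/
lemma lsmul_flip_real : (ContinuousLinearMap.lsmul ℝ ℝ : ℝ →L[ℝ] ℝ →L[ℝ] ℝ).flip =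
    ContinuousLinearMap.lsmul ℝ ℝ := by
  ext; simp

/-- Integration of a bounded function against a signed measure with a density. -/
lemma integral_withDensityᵥ_of_bounded {ν : Measure X} {w f : X → ℝ} (hw : Integrable w ν)
    (hf : Measurable f) {C : ℝ} (hC : ∀ x, |f x| ≤ C) :
    ∫ᵛ x, f x ∂•(ν.withDensityᵥ w) = ∫ x, f x * w x ∂ν := by
  have fin : ∀ u : X → ℝ, Integrable u ν →
      IsFiniteMeasure (ν.withDensity fun x => ENNReal.ofReal (u x)) :=
    fun u hu => isFiniteMeasure_withDensity_ofReal hu.2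
  have h1 := fin w hw
  have h2 := fin (fun x => -w x) hw.neg
  have int : ∀ (m : Measure X) [IsFiniteMeasure m], Integrable f m := fun m _ =>
    Integrable.of_bound hf.aestronglyMeasurable C (Filter.Eventually.of_forall hC)
  rw [withDensityᵥ_eq_withDensity_pos_part_sub_withDensity_neg_part hw,
    VectorMeasure.integral_sub_vectorMeasure, ← lsmul_flip_real,
    VectorMeasure.integral_toSignedMeasure, VectorMeasure.integral_toSignedMeasure]
  · have key : ∀ u : X → ℝ, Integrable u ν →
        ∫ x, f x ∂(ν.withDensity fun x => ENNReal.ofReal (u x)) = ∫ x, f x * max (u x) 0 ∂ν := by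
      intro u hu
      rw [integral_withDensity_eq_integral_toReal_smul₀ hu.aemeasurable.ennreal_ofReal (by simp)]
      simp [ENNReal.toReal_ofReal', mul_comm]
    have bm : ∀ u : X → ℝ, Integrable u ν → Integrable (fun x => f x * max (u x) 0) ν :=
      fun u hu => hu.pos_part.bdd_mul hf.aestronglyMeasurable (Filter.Eventually.of_forall hC)
    rw [key w hw, key (fun x => -w x) hw.neg, ← integral_sub (bm w hw) (bm (fun x => -w x) hw.neg)]
    refine integral_congr_ae (Filter.Eventually.of_forall fun x => ?_)
    simp only
    rcases le_total 0 (w x) with h | h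
    · simp [h]
    · simp [h]
  · simpa [VectorMeasure.Integrable] using int _
  · simpa [VectorMeasure.Integrable] using int _

variable [TopologicalSpace X] [CompactSpace X] [BorelSpace X]

lemma integrable_continuousMap (f : C(X, ℝ)) (ν : Measure X) [IsFiniteMeasure ν] :
    Integrable f ν :=
  Integrable.of_bound f.measurable.aestronglyMeasurable ‖f‖
    (Filter.Eventually.of_forall f.norm_coe_le_norm)

lemma integrable_continuousMap_mul (f : C(X, ℝ)) {ν : Measure X} {w : X → ℝ}
    (hw : Integrable w ν) : Integrable (fun x => f x * w x) ν :=
  hw.bdd_mul f.measurable.aestronglyMeasurable (Filter.Eventually.of_forall f.norm_coe_le_norm)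

lemma integral_withDensityᵥ_continuousMap {ν : Measure X} {w : X → ℝ} (hw : Integrable w ν)
    (f : C(X, ℝ)) : ∫ᵛ x, f x ∂•(ν.withDensityᵥ w) = ∫ x, f x * w x ∂ν :=
  integral_withDensityᵥ_of_bounded hw f.measurable f.norm_coe_le_norm

/-- The **Riesz-Markov-Kakutani theorem** on a compact space. -/
lemma exists_measure_of_nonneg [T2Space X] (R : C(X, ℝ) →ₗ[ℝ] ℝ) (hR : ∀ f, 0 ≤ f → 0 ≤ R f) :
    ∃ ρ : Measure X, IsFiniteMeasure ρ ∧ ∀ f : C(X, ℝ), ∫ x, f x ∂ρ = R f := by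
  let e : CompactlySupportedContinuousMap X ℝ →ₗ[ℝ] C(X, ℝ) :=
    { toFun := fun f => f.toContinuousMap, map_add' := fun _ _ => rfl, map_smul' := fun _ _ => rfl }
  let Λ : CompactlySupportedContinuousMap X ℝ →ₚ[ℝ] ℝ :=
    PositiveLinearMap.mk₀ (R ∘ₗ e) fun f hf => hR _ hf
  have hreg : (RealRMK.rieszMeasure Λ).Regular := inferInstance
  refine ⟨RealRMK.rieszMeasure Λ, inferInstance, fun f => ?_⟩
  exact RealRMK.integral_rieszMeasure Λ (CompactlySupportedContinuousMap.continuousMapEquiv f)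

/-- A linear functional on continuous functions that is bounded for the `L²` norm is represented
by an element of `L²`. -/
lemma exists_Lp_of_abs_le [NormalSpace X] [SecondCountableTopology X] (ρ : Measure X)
    [IsFiniteMeasure ρ]
    [ρ.WeaklyRegular] (W : C(X, ℝ) →ₗ[ℝ] ℝ) {K : ℝ}
    (hW : ∀ f, |W f| ≤ K * ‖ContinuousMap.toLp 2 ρ ℝ f‖) :
    ∃ v : Lp ℝ 2 ρ, ∀ f, W f = inner ℝ v (ContinuousMap.toLp 2 ρ ℝ f) := by
  have hd : DenseRange (ContinuousMap.toLp 2 ρ ℝ : C(X, ℝ) →L[ℝ] Lp ℝ 2 ρ).toLinearMap :=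
    ContinuousMap.toLp_denseRange ℝ ρ ℝ (by simp)
  refine ⟨(InnerProductSpace.toDual ℝ _).symm (W.extendOfNorm
    (ContinuousMap.toLp 2 ρ ℝ : C(X, ℝ) →L[ℝ] Lp ℝ 2 ρ).toLinearMap), fun f => ?_⟩
  rw [InnerProductSpace.toDual_symm_apply]
  exact (LinearMap.extendOfNorm_eq hd ⟨K, hW⟩ f).symm

lemma integral_eq_inner_toLp {ρ : Measure X} [IsFiniteMeasure ρ] [SecondCountableTopology X]
    (v : Lp ℝ 2 ρ) (f : C(X, ℝ)) :
    ∫ x, f x * v x ∂ρ = inner ℝ v (ContinuousMap.toLp 2 ρ ℝ f) := by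
  rw [L2.inner_def]
  refine integral_congr_ae ?_
  filter_upwards [ContinuousMap.coeFn_toLp (p := 2) (𝕜 := ℝ) ρ f] with x hx
  rw [hx]
  simp

lemma norm_toLp_sq {ρ : Measure X} [IsFiniteMeasure ρ] [SecondCountableTopology X] (f : C(X, ℝ)) :
    ‖ContinuousMap.toLp 2 ρ ℝ f‖ ^ 2 = ∫ x, (f * f) x ∂ρ := by
  rw [← real_inner_self_eq_norm_sq, ContinuousMap.inner_toLp]
  simp

/-- The quadratic `n²/2 · s² - a s + E` is nonnegative for all `s`, so its discriminant `a² - 2 E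
n²` is nonpositive. -/
lemma abs_le_of_forall_mul_le {a E n : ℝ} (hn : 0 ≤ n)
    (h : ∀ s : ℝ, s * a ≤ E + s ^ 2 * n ^ 2 / 2) : |a| ≤ √(2 * E) * n := by
  have hE : 0 ≤ E := by simpa using h 0
  have hd : discrim (n ^ 2 / 2) (-a) E ≤ 0 :=
    discrim_le_zero fun s => by nlinarith [h s]
  refine abs_le_of_sq_le_sq ?_ (by positivity)
  rw [mul_pow, Real.sq_sqrt (by positivity)]
  unfold discrim at hd
  nlinarith

/-- If `W b + Z c ≤ E + ½ ∫ (b² + c² / δ²) dρ` for all continuous `b` and `c`, then `W` and `Z` have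
densities with respect to `ρ` whose energy is at most `E`. -/
lemma exists_densities [T2Space X] [SecondCountableTopology X] {δ E : ℝ} (hδ : 0 < δ)
    (ρ : Measure X) [IsFiniteMeasure ρ] [ρ.WeaklyRegular] (W Z : C(X, ℝ) →ₗ[ℝ] ℝ)
    (h : ∀ b c : C(X, ℝ), W b + Z c ≤
      E + (∫ x, (b * b) x ∂ρ + (δ ^ 2)⁻¹ * ∫ x, (c * c) x ∂ρ) / 2) :
    ∃ v g : X → ℝ, Measurable v ∧ Measurable g ∧ MemLp v 2 ρ ∧ MemLp g 2 ρ ∧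
      (∀ f : C(X, ℝ), W f = ∫ x, f x * v x ∂ρ) ∧ (∀ f : C(X, ℝ), Z f = ∫ x, f x * g x ∂ρ) ∧
      ∫ x, (v x ^ 2 + δ ^ 2 * g x ^ 2) / 2 ∂ρ ≤ E := by
  simp only [← norm_toLp_sq] at h
  obtain ⟨v, hv⟩ := exists_Lp_of_abs_le ρ W (K := √(2 * E)) fun f =>
    abs_le_of_forall_mul_le (norm_nonneg _) fun s => by
      have := h (s • f) 0
      simpa [norm_smul, mul_pow] using this
  obtain ⟨g, hg⟩ := exists_Lp_of_abs_le ρ Z (K := √(2 * E) * δ⁻¹) fun f => by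
    rw [mul_assoc]
    refine abs_le_of_forall_mul_le (by positivity) fun s => ?_
    have := h 0 (s • f)
    simp only [map_zero, map_smul, zero_add, norm_smul, norm_zero, mul_pow, Real.norm_eq_abs,
      sq_abs, smul_eq_mul, ne_eq, OfNat.ofNat_ne_zero, not_false_eq_true, zero_pow] at this
    rw [mul_pow, inv_pow]
    linarith
  have hd : DenseRange (ContinuousMap.toLp 2 ρ ℝ : C(X, ℝ) → Lp ℝ 2 ρ) :=
    ContinuousMap.toLp_denseRange ℝ ρ ℝ (by simp)
  -- The two separate bounds only give existence of `v` and `g`. The sharp energy bound needs the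
  -- joint inequality on all of `L²`, by density of continuous functions.
  have joint : ∀ b c : Lp ℝ 2 ρ,
      inner ℝ v b + inner ℝ g c ≤ E + (‖b‖ ^ 2 + (δ ^ 2)⁻¹ * ‖c‖ ^ 2) / 2 := by
    intro b c
    refine hd.induction_on₂ (p := fun b c =>
      inner ℝ v b + inner ℝ g c ≤ E + (‖b‖ ^ 2 + (δ ^ 2)⁻¹ * ‖c‖ ^ 2) / 2)
      (isClosed_le (by fun_prop) (by fun_prop)) ?_ b c
    intro b c
    rw [← hv, ← hg]
    exact h b c
  have sq : ∀ u : Lp ℝ 2 ρ, ∫ x, u x ^ 2 ∂ρ = ‖u‖ ^ 2 := fun u => by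
    rw [← real_inner_self_eq_norm_sq, L2.inner_def]
    simp [pow_two]
  refine ⟨v, g, (Lp.stronglyMeasurable v).measurable, (Lp.stronglyMeasurable g).measurable,
    Lp.memLp v, Lp.memLp g, fun f => by rw [hv, integral_eq_inner_toLp],
    fun f => by rw [hg, integral_eq_inner_toLp], ?_⟩
  rw [integral_div, integral_add (Lp.memLp v).integrable_sq ((Lp.memLp g).integrable_sq.const_mul _),
    integral_const_mul, sq, sq]
  -- Equality case of Young: the left side is then twice the energy, and the quadratic term on the
  -- right is the energy.
  have := joint v (δ ^ 2 • g)
  rw [inner_smul_right, real_inner_self_eq_norm_sq, real_inner_self_eq_norm_sq, norm_smul, mul_pow,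
    Real.norm_of_nonneg (by positivity)] at this
  field_simp at this
  linarith

end General

section Functionals

variable {X : Type*} [MeasurableSpace X] [TopologicalSpace X] [CompactSpace X] [BorelSpace X]

/-- The functional `f ↦ ∫ f w dν` on continuous functions. -/
def densityFunctional (ν : Measure X) (w : X → ℝ) (hw : Integrable w ν) : C(X, ℝ) →ₗ[ℝ] ℝ where
  toFun f := ∫ x, f x * w x ∂ν
  map_add' f g := by
    simp only [ContinuousMap.add_apply, add_mul]
    exact integral_add (integrable_continuousMap_mul f hw) (integrable_continuousMap_mul g hw)
  map_smul' c f := by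
    simp [mul_assoc, integral_const_mul]

lemma densityFunctional_apply (ν : Measure X) (w : X → ℝ) (hw : Integrable w ν) (f : C(X, ℝ)) :
    densityFunctional ν w hw f = ∫ x, f x * w x ∂ν := rfl

end Functionals

/-! ### The dual formulation: bounds, convexity, symmetry, compactness -/

/-- A pointwise bounded sequence of linear functionals converges along an ultrafilter. -/
lemma exists_tendsto_hyperfilter {V : Type*} [AddCommGroup V] [Module ℝ V] (L : ℕ → V →ₗ[ℝ] ℝ)
    (hL : ∀ f, ∃ C, ∀ n, |L n f| ≤ C) :
    ∃ Λ : V →ₗ[ℝ] ℝ, ∀ f, Filter.Tendsto (fun n => L n f) (Filter.hyperfilter ℕ : Filter ℕ)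
      (nhds (Λ f)) := by
  -- One ultrafilter serves all `f` at once, so no diagonal extraction is needed.
  have h : ∀ f, ∃ l, Filter.Tendsto (fun n => L n f) (Filter.hyperfilter ℕ : Filter ℕ) (nhds l) := by
    intro f
    obtain ⟨C, hC⟩ := hL f
    obtain ⟨l, -, hl⟩ := (isCompact_Icc (a := -C) (b := C)).ultrafilter_le_nhds
      ((Filter.hyperfilter ℕ).map fun n => L n f)
      (Filter.le_principal_iff.2 (Filter.mem_map.2
        (Filter.univ_mem' fun n => abs_le.1 (hC n))))
    exact ⟨l, hl⟩
  choose l hl using h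
  refine ⟨⟨⟨l, fun f g => ?_⟩, fun c f => ?_⟩, hl⟩
  · refine tendsto_nhds_unique (hl (f + g)) ?_
    simpa using (hl f).add (hl g)
  · refine tendsto_nhds_unique (hl (c • f)) ?_
    simpa using (hl f).const_mul c

/-- The weak formulation, through linear functionals on `C([0,1] × 𝕊¹)`, of a triple that satisfies
the continuity equation and whose energy is at most `E`. -/
structure IsAdmissible (δ E : ℝ) (ρ₀ ρ₁ : Measure Circle)
    (R W Z : C(I × Circle, ℝ) →ₗ[ℝ] ℝ) : Prop where
  nonneg : ∀ f, 0 ≤ f → 0 ≤ R f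
  continuity : ∀ φ (hφ : IsC1 φ), R (restrictTime (dt φ) hφ.continuous_dt) +
    W (restrictTime (dθ φ) hφ.continuous_dθ) + Z (restrictTime φ hφ.continuous) =
    (∫ x, φ (1, x) ∂ρ₁) - ∫ x, φ (0, x) ∂ρ₀
  young : ∀ b c, W b + Z c ≤ E + R (b * b + (δ ^ 2)⁻¹ • (c * c)) / 2

namespace IsAdmissible

variable {δ E : ℝ} {ρ₀ ρ₁ : Measure Circle} {R W Z R' W' Z' : C(I × Circle, ℝ) →ₗ[ℝ] ℝ}

lemma mono (h : IsAdmissible δ E ρ₀ ρ₁ R W Z) {f g : C(I × Circle, ℝ)} (hfg : f ≤ g) :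
    R f ≤ R g := by
  have := h.nonneg (g - f) (sub_nonneg.2 hfg)
  rw [map_sub] at this
  linarith

lemma energy_nonneg (h : IsAdmissible δ E ρ₀ ρ₁ R W Z) : 0 ≤ E := by
  simpa using h.young 0 0

lemma abs_le (h : IsAdmissible δ E ρ₀ ρ₁ R W Z) (f : C(I × Circle, ℝ)) : |R f| ≤ ‖f‖ * R 1 := by
  have e : ‖f‖ * R 1 = R (‖f‖ • (1 : C(I × Circle, ℝ))) := by simp
  rw [_root_.abs_le, e, ← map_neg]
  constructor
  · refine h.mono fun p => ?_
    simpa using neg_le_of_abs_le (f.norm_coe_le_norm p)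
  · refine h.mono fun p => ?_
    simpa using le_of_abs_le (f.norm_coe_le_norm p)

lemma young_left (h : IsAdmissible δ E ρ₀ ρ₁ R W Z) (b : C(I × Circle, ℝ)) :
    |W b| ≤ E + R (b * b) / 2 := by
  have h1 := h.young b 0
  have h2 := h.young (-b) 0
  simp only [map_neg, map_zero, add_zero, mul_zero, smul_zero, neg_mul_neg] at h1 h2
  exact _root_.abs_le.2 ⟨by linarith, h1⟩

lemma young_right (h : IsAdmissible δ E ρ₀ ρ₁ R W Z) (c : C(I × Circle, ℝ)) :
    |Z c| ≤ E + (δ ^ 2)⁻¹ * R (c * c) / 2 := by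
  have h1 := h.young 0 c
  have h2 := h.young 0 (-c)
  simp only [map_neg, map_zero, zero_add, mul_zero, neg_mul_neg, map_smul, smul_eq_mul] at h1 h2
  exact _root_.abs_le.2 ⟨by linarith, h1⟩

/-- The continuity equation for functions of time alone. -/
lemma continuity_time (h : IsAdmissible δ E ρ₀ ρ₁ R W Z) {u : ℝ → ℝ} (hu : ContDiff ℝ 1 u) :
    R (restrictTime (fun p => deriv u p.1)
      ((hu.continuous_deriv le_rfl).comp continuous_fst)) +
      Z (restrictTime (fun p => u p.1) (hu.continuous.comp continuous_fst)) =
      ρ₁.real univ * u 1 - ρ₀.real univ * u 0 := by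
  have := h.continuity _ (isC1_of_time hu)
  have e : restrictTime (dθ fun p => u p.1) (isC1_of_time hu).continuous_dθ = 0 := by
    ext p; simp [dθ_of_time]
  rw [e, map_zero, add_zero] at this
  simpa using! this

/-- Testing with `φ = t` gives `R 1 + Z t = ρ₁(𝕊¹)`. Young with `c = -δ² t` gives `-Z t ≤ E/δ² + R
(t²)/2`, and `R (t²) ≤ R 1` lets half of the mass be absorbed on the left. -/
lemma mass_le (hδ : 0 < δ) (h : IsAdmissible δ E ρ₀ ρ₁ R W Z) :
    R 1 ≤ 2 * (ρ₁.real univ + E / δ ^ 2) := by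
  have hc := h.continuity_time (u := fun t => t) contDiff_id
  set T := restrictTime (fun p => p.1) continuous_fst
  have e1 : restrictTime (fun p => deriv (fun t : ℝ => t) p.1)
      ((contDiff_id.continuous_deriv le_rfl).comp continuous_fst) = 1 := by
    ext p; simp
  rw [e1] at hc
  have hT : R (T * T) ≤ R 1 := h.mono fun p => by
    have h0 := p.1.2.1
    have h1 := p.1.2.2
    change (p.1 : ℝ) * p.1 ≤ 1
    nlinarith
  have hy := h.young 0 (-(δ ^ 2) • T)
  have e2 : (0 : C(I × Circle, ℝ)) * 0 + (δ ^ 2)⁻¹ • (-(δ ^ 2) • T * -(δ ^ 2) • T) =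
      δ ^ 2 • (T * T) := by
    ext p
    simp
    field_simp
  rw [e2] at hy
  simp only [map_zero, zero_add, map_smul, smul_eq_mul] at hy
  have hZ : -Z T ≤ E / δ ^ 2 + R (T * T) / 2 := by
    rw [← sub_le_iff_le_add, le_div_iff₀ (by positivity)]
    linarith
  simp only [mul_one, mul_zero, sub_zero] at hc
  linarith

/-- Convexity of the energy, in dual form: for fixed `E` every condition is affine in `(R, W, Z)`.
-/
lemma half_add (h : IsAdmissible δ E ρ₀ ρ₁ R W Z) (h' : IsAdmissible δ E ρ₀ ρ₁ R' W' Z') :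
    IsAdmissible δ E ρ₀ ρ₁ ((1 / 2 : ℝ) • (R + R')) ((1 / 2 : ℝ) • (W + W'))
      ((1 / 2 : ℝ) • (Z + Z')) where
  nonneg f hf := by
    have h1 := h.nonneg f hf
    have h2 := h'.nonneg f hf
    simp
    positivity
  continuity φ hφ := by
    have h1 := h.continuity φ hφ
    have h2 := h'.continuity φ hφ
    simp only [LinearMap.smul_apply, LinearMap.add_apply, smul_eq_mul]
    linarith
  young b c := by
    have h1 := h.young b c
    have h2 := h'.young b c
    simp only [LinearMap.smul_apply, LinearMap.add_apply, smul_eq_mul]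
    linarith

end IsAdmissible

/-- The action of the antipodal map on functions. -/
def flipFun : C(I × Circle, ℝ) →ₗ[ℝ] C(I × Circle, ℝ) where
  toFun f := f.comp flip
  map_add' _ _ := rfl
  map_smul' _ _ := rfl

@[simp] lemma flipFun_apply (f : C(I × Circle, ℝ)) (p : I × Circle) :
    flipFun f p = f (p.1, antipode p.2) := rfl

@[simp] lemma flipFun_flipFun (f : C(I × Circle, ℝ)) : flipFun (flipFun f) = f := by
  ext p; simp

lemma integral_comp_antipode {ρ : Measure Circle} (h : ρ.map antipode = ρ) {f : Circle → ℝ}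
    (hf : Continuous f) : ∫ x, f (antipode x) ∂ρ = ∫ x, f x ∂ρ := by
  conv_rhs => rw [← h]
  rw [integral_map measurable_antipode.aemeasurable hf.aestronglyMeasurable]

/-- The antipodal map is the rotation by `π`: it commutes with `∂_t` and `∂_θ` without a sign, and
it fixes the boundary terms by hypothesis. -/
lemma IsAdmissible.flip {δ E : ℝ} {ρ₀ ρ₁ : Measure Circle} {R W Z : C(I × Circle, ℝ) →ₗ[ℝ] ℝ}
    (h : IsAdmissible δ E ρ₀ ρ₁ R W Z) (h₀ : ρ₀.map antipode = ρ₀) (h₁ : ρ₁.map antipode = ρ₁) :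
    IsAdmissible δ E ρ₀ ρ₁ (R ∘ₗ flipFun) (W ∘ₗ flipFun) (Z ∘ₗ flipFun) where
  nonneg f hf := h.nonneg _ fun p => hf (p.1, antipode p.2)
  continuity φ hφ := by
    have := h.continuity _ (isC1_comp_antipode hφ)
    have hc := hφ.continuous
    have eb : ∀ (t : ℝ) {ρ : Measure Circle}, ρ.map antipode = ρ →
        ∫ x, φ (t, antipode x) ∂ρ = ∫ x, φ (t, x) ∂ρ := fun t ρ hρ =>
      integral_comp_antipode hρ (f := fun x => φ (t, x)) (by fun_prop)
    have et : restrictTime _ (isC1_comp_antipode hφ).continuous_dθ =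
        flipFun (restrictTime _ hφ.continuous_dθ) := by
      ext p; simp [dθ_comp_antipode]
    rw [eb 1 h₁, eb 0 h₀, et] at this
    exact this
  young b c := h.young (flipFun b) (flipFun c)

/-- An admissible triple may be taken invariant under the antipodal map. -/
lemma exists_symmetric_admissible {δ E : ℝ} {ρ₀ ρ₁ : Measure Circle}
    {R W Z : C(I × Circle, ℝ) →ₗ[ℝ] ℝ}
    (h : IsAdmissible δ E ρ₀ ρ₁ R W Z) (h₀ : ρ₀.map antipode = ρ₀) (h₁ : ρ₁.map antipode = ρ₁) :
    ∃ R W Z, IsAdmissible δ E ρ₀ ρ₁ R W Z ∧ (∀ f, R (flipFun f) = R f) ∧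
      (∀ f, W (flipFun f) = W f) ∧ ∀ f, Z (flipFun f) = Z f :=
  ⟨_, _, _, h.half_add (h.flip h₀ h₁), fun f => by simp [add_comm], fun f => by simp [add_comm],
    fun f => by simp [add_comm]⟩

/-- Admissibility is stable under limits of the energy bound. -/
lemma exists_admissible_of_tendsto {δ : ℝ} (hδ : 0 < δ) {ρ₀ ρ₁ : Measure Circle} {E : ℕ → ℝ}
    {E' : ℝ} (hE : Filter.Tendsto E Filter.atTop (nhds E'))
    (h : ∀ n, ∃ R W Z, IsAdmissible δ (E n) ρ₀ ρ₁ R W Z) :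
    ∃ R W Z, IsAdmissible δ E' ρ₀ ρ₁ R W Z := by
  choose R W Z h using h
  obtain ⟨B, hB⟩ := hE.bddAbove_range
  replace hB : ∀ n, E n ≤ B := fun n => hB ⟨n, rfl⟩
  set M := 2 * (ρ₁.real univ + B / δ ^ 2)
  have hM : ∀ n, R n 1 ≤ M := fun n => ((h n).mass_le hδ).trans (by
    simp only [M]
    gcongr
    exact hB n)
  have hR : ∀ f n, |R n f| ≤ ‖f‖ * M := fun f n =>
    ((h n).abs_le f).trans (mul_le_mul_of_nonneg_left (hM n) (norm_nonneg f))
  obtain ⟨R', hR'⟩ := exists_tendsto_hyperfilter R fun f => ⟨_, hR f⟩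
  obtain ⟨W', hW'⟩ := exists_tendsto_hyperfilter W fun f => ⟨B + ‖f * f‖ * M / 2, fun n =>
    ((h n).young_left f).trans (by
      gcongr
      · exact hB n
      · exact le_of_abs_le (hR _ n))⟩
  obtain ⟨Z', hZ'⟩ := exists_tendsto_hyperfilter Z fun f =>
    ⟨B + (δ ^ 2)⁻¹ * (‖f * f‖ * M) / 2, fun n => ((h n).young_right f).trans (by
      gcongr
      · exact hB n
      · exact le_of_abs_le (hR _ n))⟩
  refine ⟨R', W', Z', fun f hf => ?_, fun φ hφ => ?_, fun b c => ?_⟩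
  · exact ge_of_tendsto' (hR' f) fun n => (h n).nonneg f hf
  · refine tendsto_nhds_unique (((hR' _).add (hW' _)).add (hZ' _)) ?_
    simp only [(h _).continuity φ hφ]
    exact tendsto_const_nhds
  -- The hyperfilter refines `atTop`, so the energies converge along it as well.
  · exact le_of_tendsto_of_tendsto' ((hW' b).add (hZ' c))
      ((hE.mono_left Nat.hyperfilter_le_atTop).add ((hR' _).div_const 2))
      fun n => (h n).young b c

/-! ### From triples of finite energy to admissible functionals -/

/-- Pointwise Young inequality: for `r > 0` the defect is a sum of squares over `2r`; otherwise
finite cost forces `r = w = z = 0`. -/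
lemma mul_add_mul_le_cost {δ r w z : ℝ} (hδ : 0 < δ) (hfin : cost δ r w z < ∞) (b c : ℝ) :
    b * w + c * z ≤ (cost δ r w z).toReal + (b * b + (δ ^ 2)⁻¹ * (c * c)) * r / 2 := by
  unfold cost at *
  split_ifs at * with h1 h2
  · rw [ENNReal.toReal_ofReal (by positivity)]
    have e : (w ^ 2 + δ ^ 2 * z ^ 2) / (2 * r) + (b * b + (δ ^ 2)⁻¹ * (c * c)) * r / 2
        - (b * w + c * z) = ((w - r * b) ^ 2 + (δ * z - r * c / δ) ^ 2) / (2 * r) := by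
      field_simp
      ring
    have : 0 ≤ ((w - r * b) ^ 2 + (δ * z - r * c / δ) ^ 2) / (2 * r) := by positivity
    linarith
  · obtain ⟨rfl, rfl, rfl⟩ := h2
    simp
  · simp at hfin

lemma totalVariation_ω_le_ref (μ : Path) : μ.ω.totalVariation ≤ μ.ref :=
  (Measure.le_add_left le_rfl).trans (Measure.le_add_right le_rfl)

lemma totalVariation_ζ_le_ref (μ : Path) : μ.ζ.totalVariation ≤ μ.ref :=
  Measure.le_add_left le_rfl

lemma ρ_le_ref (μ : Path) : (μ.ρ : Measure (I × Circle)) ≤ μ.ref :=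
  (Measure.le_add_right le_rfl).trans (Measure.le_add_right le_rfl)

lemma withDensityᵥ_rnDeriv_of_ac {X : Type*} [MeasurableSpace X] {s : SignedMeasure X}
    {ν : Measure X} [SigmaFinite ν] (h : s.totalVariation ≪ ν) :
    ν.withDensityᵥ (s.rnDeriv ν) = s := by
  refine SignedMeasure.withDensityᵥ_rnDeriv_eq s ν ?_
  rw [SignedMeasure.absolutelyContinuous_ennreal_iff]
  rwa [show ν.toENNRealVectorMeasure.ennrealToMeasure = ν from
    VectorMeasure.equivMeasure.right_inv ν]

/-- A triple of finite energy is admissible. -/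
lemma exists_admissible_of_mem_CE {δ : ℝ} (hδ : 0 < δ) {ρ₀ ρ₁ : Measure Circle} {μ : Path}
    (hμ : μ ∈ CE ρ₀ ρ₁) (hfin : energy δ μ ≠ ∞) :
    ∃ R W Z, IsAdmissible δ (energy δ μ).toReal ρ₀ ρ₁ R W Z := by
  set ν := μ.ref with hν
  set r : I × Circle → ℝ := fun p => ((μ.ρ : Measure (I × Circle)).rnDeriv ν p).toReal with hr
  set w := μ.ω.rnDeriv ν with hw
  set z := μ.ζ.rnDeriv ν with hz
  have ri : Integrable r ν := Measure.integrable_toReal_rnDeriv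
  have wi : Integrable w ν := SignedMeasure.integrable_rnDeriv _ _
  have zi : Integrable z ν := SignedMeasure.integrable_rnDeriv _ _
  have er : ∀ f : I × Circle → ℝ, ∫ p, f p ∂(μ.ρ : Measure (I × Circle)) = ∫ p, f p * r p ∂ν := by
    intro f
    have hac : (μ.ρ : Measure (I × Circle)) ≪ ν := (ρ_le_ref μ).absolutelyContinuous
    have := Measure.haveLebesgueDecomposition_of_sigmaFinite (μ.ρ : Measure (I × Circle)) ν
    rw [← integral_rnDeriv_smul hac]
    simp [hr, mul_comm]
  have ew : ∀ f : C(I × Circle, ℝ), ∫ᵛ p, f p ∂•μ.ω = ∫ p, f p * w p ∂ν := fun f => by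
    conv_lhs => rw [← withDensityᵥ_rnDeriv_of_ac (totalVariation_ω_le_ref μ).absolutelyContinuous]
    exact integral_withDensityᵥ_continuousMap wi f
  have ez : ∀ f : C(I × Circle, ℝ), ∫ᵛ p, f p ∂•μ.ζ = ∫ p, f p * z p ∂ν := fun f => by
    conv_lhs => rw [← withDensityᵥ_rnDeriv_of_ac (totalVariation_ζ_le_ref μ).absolutelyContinuous]
    exact integral_withDensityᵥ_continuousMap zi f
  refine ⟨densityFunctional ν r ri, densityFunctional ν w wi, densityFunctional ν z zi,
    fun f hf => ?_, fun φ hφ => ?_, fun b c => ?_⟩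
  · exact integral_nonneg fun p => mul_nonneg (hf p) ENNReal.toReal_nonneg
  · simp only [densityFunctional_apply]
    rw [← er, ← ew, ← ez]
    exact hμ φ hφ
  · have hm : Measurable fun p => cost δ (r p) (w p) (z p) :=
      (measurable_cost δ).comp ((Measure.measurable_rnDeriv _ _).ennreal_toReal.prodMk
        ((SignedMeasure.measurable_rnDeriv _ _).prodMk (SignedMeasure.measurable_rnDeriv _ _)))
    have hlt : ∀ᵐ p ∂ν, cost δ (r p) (w p) (z p) < ∞ := ae_lt_top hm hfin
    have he : (energy δ μ).toReal = ∫ p, (cost δ (r p) (w p) (z p)).toReal ∂ν :=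
      (integral_toReal hm.aemeasurable hlt).symm
    have hci : Integrable (fun p => (cost δ (r p) (w p) (z p)).toReal) ν :=
      integrable_toReal_of_lintegral_ne_top hm.aemeasurable hfin
    simp only [densityFunctional_apply]
    rw [he, ← integral_div, ← integral_add (integrable_continuousMap_mul b wi)
      (integrable_continuousMap_mul c zi), ← integral_add hci
      ((integrable_continuousMap_mul _ ri).div_const 2)]
    refine integral_mono_ae ((integrable_continuousMap_mul b wi).add
      (integrable_continuousMap_mul c zi))
      (hci.add ((integrable_continuousMap_mul _ ri).div_const 2)) ?_
    filter_upwards [hlt] with p hp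
    exact mul_add_mul_le_cost hδ hp (b p) (c p)

/-! ### A competitor of finite energy -/

lemma integral_unitInterval (f : ℝ → ℝ) : ∫ t : I, f t = ∫ t in (0 : ℝ)..1, f t := by
  rw [intervalIntegral.integral_of_le zero_le_one, ← integral_Icc_eq_integral_Ioc]
  exact integral_subtype measurableSet_Icc f

/-- Integration by parts in time. -/
lemma integral_deriv_mul_add_mul_deriv {u s s' : ℝ → ℝ} (hu : ContDiff ℝ 1 u)
    (hs : ∀ t, HasDerivAt s (s' t) t) (hs' : Continuous s') :
    ∫ t : I, (deriv u t * s t + u t * s' t) = u 1 * s 1 - u 0 * s 0 := by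
  have hsc : Continuous s := continuous_iff_continuousAt.2 fun t => (hs t).continuousAt
  have hud := hu.continuous_deriv le_rfl
  have huc := hu.continuous
  rw [integral_unitInterval fun t => deriv u t * s t + u t * s' t]
  have hc : Continuous fun t => deriv u t * s t + u t * s' t := by fun_prop
  refine intervalIntegral.integral_eq_sub_of_hasDerivAt (f := fun t => u t * s t) (fun t _ => ?_)
    (hc.intervalIntegrable _ _)
  exact ((hu.differentiable one_ne_zero) t).hasDerivAt.mul (hs t)

/-- The continuity equation for the measure `s(t) dt ⊗ m`. -/
lemma integral_prod_dt_add {φ : ℝ × Circle → ℝ} (hφ : IsC1 φ) (m : Measure Circle)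
    [IsFiniteMeasure m] {s s' : ℝ → ℝ} (hs : ∀ t, HasDerivAt s (s' t) t) (hs' : Continuous s') :
    ∫ p, restrictTime (dt φ) hφ.continuous_dt p * s p.1 ∂((volume : Measure I).prod m) +
      ∫ p, restrictTime φ hφ.continuous p * s' p.1 ∂((volume : Measure I).prod m) =
      (∫ x, φ (1, x) ∂m) * s 1 - (∫ x, φ (0, x) ∂m) * s 0 := by
  have hsc : Continuous s := continuous_iff_continuousAt.2 fun t => (hs t).continuousAt
  have c0 := hφ.continuous
  have c1 := hφ.continuous_dt
  have i1 : Integrable (fun p => restrictTime (dt φ) hφ.continuous_dt p * s p.1)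
      ((volume : Measure I).prod m) :=
    integrable_continuousMap (restrictTime (fun p => dt φ p * s p.1) (by fun_prop)) _
  have i2 : Integrable (fun p => restrictTime φ hφ.continuous p * s' p.1)
      ((volume : Measure I).prod m) :=
    integrable_continuousMap (restrictTime (fun p => φ p * s' p.1) (by fun_prop)) _
  have hφi : ∀ t : ℝ, Integrable (fun x => φ (t, x)) m := fun t =>
    integrable_continuousMap ⟨fun x => φ (t, x), by fun_prop⟩ m
  rw [← integral_add i1 i2, integral_prod_symm _ (by exact i1.add i2), ← integral_mul_const,
    ← integral_mul_const, ← integral_sub ((hφi 1).mul_const _) ((hφi 0).mul_const _)]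
  refine integral_congr_ae (Filter.Eventually.of_forall fun x => ?_)
  have hu : ContDiff ℝ 1 fun t => φ (t, x) := by
    obtain ⟨θ, rfl⟩ := Circle.exp_surjective x
    exact ContDiff.comp (g := fun p : ℝ × ℝ => φ (p.1, Circle.exp p.2)) hφ
      (contDiff_id.prodMk contDiff_const)
  exact integral_deriv_mul_add_mul_deriv hu hs hs'

/-- The triple `ρ = dt ⊗ ((1-t)² ρ₀ + t² ρ₁)`, `ω = 0`, `ζ = ∂_t ρ` is admissible. -/
lemma exists_admissible {δ : ℝ} (hδ : 0 < δ) (ρ₀ ρ₁ : Measure Circle) [IsFiniteMeasure ρ₀]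
    [IsFiniteMeasure ρ₁] :
    ∃ E R W Z, IsAdmissible δ E ρ₀ ρ₁ R W Z := by
  set ν₀ := (volume : Measure I).prod ρ₀
  set ν₁ := (volume : Measure I).prod ρ₁
  have hi : ∀ (s : ℝ → ℝ) (ν : Measure (I × Circle)) [IsFiniteMeasure ν], Continuous s →
      Integrable (fun p : I × Circle => s p.1) ν := fun s ν _ hs =>
    integrable_continuousMap ⟨fun p => s p.1, by fun_prop⟩ ν
  have a0 := hi (fun t => (1 - t) ^ 2) ν₀ (by fun_prop)
  have a1 := hi (fun t => t ^ 2) ν₁ (by fun_prop)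
  have b0 := hi (fun t => -2 * (1 - t)) ν₀ (by fun_prop)
  have b1 := hi (fun t => 2 * t) ν₁ (by fun_prop)
  -- Both weights `s = (1-t)²` and `s = t²` satisfy `s'² = 4 s`, so the cost `δ² s'²/(2s)` is `2
  -- δ²`, bounded even near the zero of `s`.
  refine ⟨2 * δ ^ 2 * ν₀.real univ + 2 * δ ^ 2 * ν₁.real univ,
    densityFunctional ν₀ _ a0 + densityFunctional ν₁ _ a1, 0,
    densityFunctional ν₀ _ b0 + densityFunctional ν₁ _ b1, fun f hf => ?_, fun φ hφ => ?_,
    fun b c => ?_⟩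
  · exact add_nonneg (integral_nonneg fun p => mul_nonneg (hf p) (sq_nonneg _))
      (integral_nonneg fun p => mul_nonneg (hf p) (sq_nonneg _))
  · have e0 := integral_prod_dt_add hφ ρ₀ (s := fun t => (1 - t) ^ 2) (s' := fun t => -2 * (1 - t))
      (fun t => by
        have := ((hasDerivAt_id t).const_sub 1).pow 2
        simpa using! this) (by fun_prop)
    have e1 := integral_prod_dt_add hφ ρ₁ (s := fun t => t ^ 2) (s' := fun t => 2 * t)
      (fun t => by simpa using hasDerivAt_pow 2 t) (by fun_prop)
    simp only [LinearMap.add_apply, LinearMap.zero_apply, densityFunctional_apply]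
    norm_num at e0 e1
    simp only [restrictTime_apply]
    simp only [ν₀, ν₁]
    norm_num
    linarith
  · have key : ∀ (ν : Measure (I × Circle)) [IsFiniteMeasure ν] (s s' : I × Circle → ℝ)
        (hs : Integrable s ν) (hs' : Integrable s' ν) (_ : ∀ p, s' p ^ 2 = 4 * s p),
        densityFunctional ν s' hs' c ≤ 2 * δ ^ 2 * ν.real univ +
          densityFunctional ν s hs (b * b + (δ ^ 2)⁻¹ • (c * c)) / 2 := by
      intro ν _ s s' hs hs' h
      have ec : 2 * δ ^ 2 * ν.real univ = ∫ _, 2 * δ ^ 2 ∂ν := by simp [mul_comm]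
      simp only [densityFunctional_apply]
      rw [ec, ← integral_div, ← integral_add (integrable_const _)
        ((integrable_continuousMap_mul _ hs).div_const 2)]
      refine integral_mono (integrable_continuousMap_mul c hs') ((integrable_const _).add
        ((integrable_continuousMap_mul _ hs).div_const 2)) fun p => ?_
      have hp := h p
      have hb : 0 ≤ b p * b p * s p := by nlinarith [sq_nonneg (s' p), mul_self_nonneg (b p)]
      have e : 2 * δ ^ 2 + (δ ^ 2)⁻¹ * (c p * c p) * s p / 2 - c p * s' p =
          (2 * δ - c p * s' p / (2 * δ)) ^ 2 / 2 := by
        rw [show s p = s' p ^ 2 / 4 by linarith]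
        field_simp
        ring
      have := sq_nonneg (2 * δ - c p * s' p / (2 * δ))
      simp only [ContinuousMap.add_apply, ContinuousMap.mul_apply,
        ContinuousMap.smul_apply, smul_eq_mul]
      linarith
    have k0 := key ν₀ _ _ a0 b0 fun p => by ring
    have k1 := key ν₁ _ _ a1 b1 fun p => by ring
    simp only [LinearMap.add_apply, LinearMap.zero_apply]
    linarith

/-! ### Disintegration in time -/

/-- Domination on nonnegative continuous functions gives absolute continuity. -/
lemma absolutelyContinuous_of_integral_le {X : Type*} [PseudoEMetricSpace X] [MeasurableSpace X]
    [BorelSpace X] {m n : Measure X} [IsFiniteMeasure m] [IsFiniteMeasure n] {C : ℝ} (hC : 0 ≤ C)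
    (h : ∀ f : X → ℝ, Continuous f → (∀ x, 0 ≤ f x) → ∫ x, f x ∂m ≤ C * ∫ x, f x ∂n) : m ≪ n := by
  -- Thickened indicators decrease to the indicator of a closed set; inner regularity then handles
  -- Borel sets.
  have closed : ∀ K, IsClosed K → m K ≤ ENNReal.ofReal C * n K := by
    intro K hK
    have hpos : ∀ k : ℕ, (0 : ℝ) < 1 / ((k : ℝ) + 1) := fun k => by positivity
    have hm := tendsto_lintegral_thickenedIndicator_of_isClosed m hK hpos
      tendsto_one_div_add_atTop_nhds_zero_nat
    have hn := tendsto_lintegral_thickenedIndicator_of_isClosed n hK hpos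
      tendsto_one_div_add_atTop_nhds_zero_nat
    refine le_of_tendsto_of_tendsto' hm
      (ENNReal.Tendsto.const_mul hn (Or.inr ENNReal.ofReal_ne_top)) fun k => ?_
    set f := thickenedIndicator (hpos k) K
    have hf : Continuous fun x => (f x : ℝ) := NNReal.continuous_coe.comp f.continuous
    have fi : ∀ (q : Measure X) [IsFiniteMeasure q], Integrable (fun x => (f x : ℝ)) q :=
      fun q _ => Integrable.of_bound hf.aestronglyMeasurable 1 (Filter.Eventually.of_forall fun x => by
        rw [NNReal.norm_eq]
        have h1 : f x ≤ 1 := thickenedIndicator_le_one (hpos k) K x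
        exact_mod_cast h1)
    have e : ∀ (q : Measure X) [IsFiniteMeasure q],
        ∫⁻ x, (f x : ℝ≥0∞) ∂q = ENNReal.ofReal (∫ x, (f x : ℝ) ∂q) := fun q _ => by
      rw [ofReal_integral_eq_lintegral_ofReal (fi q) (Filter.Eventually.of_forall fun x => (f x).2)]
      simp
    rw [e, e, ← ENNReal.ofReal_mul hC]
    exact ENNReal.ofReal_le_ofReal (h _ hf fun x => (f x).2)
  refine Measure.AbsolutelyContinuous.mk fun s hs hns => ?_
  rw [hs.measure_eq_iSup_isClosed_of_ne_top (measure_ne_top m s)]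
  simp only [ENNReal.iSup_eq_zero]
  intro K hKs hK
  have := closed K hK
  rwa [measure_mono_null hKs hns, mul_zero, nonpos_iff_eq_zero] at this

lemma measurable_flip : Measurable flip := flip.continuous.measurable

/-- An invariant measure whose time marginal is absolutely continuous disintegrates into invariant
measures. -/
lemma exists_symmetric_disintegration (ρ : Measure (I × Circle)) [IsFiniteMeasure ρ]
    (hρ : ρ.map flip = ρ) (hac : ρ.fst ≪ volume) :
    ∃ κ : Kernel I Circle, Disintegrates ρ κ ∧ ∀ t, (κ t).map antipode = κ t := by
  -- The factor `1/2` prepares for adding the reflected kernel, which makes invariance exact at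
  -- every `t`. `toNNReal` keeps every fibre finite, including on the null set where the derivative
  -- is infinite.
  set m : I → NNReal := fun t => (ρ.fst.rnDeriv volume t).toNNReal / 2 with hm
  have mm : Measurable m := (Measure.measurable_rnDeriv _ _).ennreal_toNNReal.div_const 2
  set κ₁ : Kernel I Circle := ρ.condKernel.withDensity (fun t _ => (m t : ℝ≥0∞)) with hκ₁
  have mu : Measurable (Function.uncurry fun (t : I) (_ : Circle) => (m t : ℝ≥0∞)) :=
    (mm.comp measurable_fst).coe_nnreal_ennreal
  have hκt : ∀ t, κ₁ t = m t • ρ.condKernel t := fun t => by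
    rw [hκ₁, Kernel.withDensity_apply _ mu, withDensity_const]
    rfl
  have sf : IsSFiniteKernel κ₁ := Kernel.IsSFiniteKernel.withDensity _ fun _ _ => ENNReal.coe_ne_top
  have := Measure.haveLebesgueDecomposition_of_sigmaFinite ρ.fst volume
  have half : ∀ s, MeasurableSet s → (volume ⊗ₘ κ₁) s = 2⁻¹ * ρ s := by
    intro s hs
    conv_rhs => rw [← ρ.disintegrate ρ.condKernel]
    rw [Measure.compProd_apply hs, Measure.compProd_apply hs, ← lintegral_rnDeriv_mul hac
      (Kernel.measurable_kernel_prodMk_left hs).aemeasurable,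
      ← lintegral_const_mul' _ _ (by simp)]
    refine lintegral_congr_ae ?_
    filter_upwards [Measure.rnDeriv_ne_top ρ.fst volume] with t ht
    rw [hκt, Measure.smul_apply, ENNReal.smul_def, smul_eq_mul, hm, ← mul_assoc]
    congr 1
    simp only
    rw [ENNReal.coe_div two_ne_zero, ENNReal.coe_toNNReal ht, div_eq_mul_inv, mul_comm]
    rfl
  refine ⟨κ₁ + κ₁.map antipode, ⟨inferInstance, fun t => ?_, ?_⟩, fun t => ?_⟩
  · have : IsFiniteMeasure (κ₁ t) := by rw [hκt]; infer_instance
    rw [_root_.add_apply, Kernel.map_apply _ measurable_antipode]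
    infer_instance
  · have hmap : (volume : Measure I) ⊗ₘ κ₁.map antipode = (volume ⊗ₘ κ₁).map flip := by
      ext s hs
      rw [Measure.compProd_apply hs, Measure.map_apply measurable_flip hs,
        Measure.compProd_apply (measurable_flip hs)]
      refine lintegral_congr fun t => ?_
      rw [Kernel.map_apply' _ measurable_antipode _ (measurable_prodMk_left hs)]
      rfl
    rw [Measure.compProd_add_right, hmap]
    ext s hs
    rw [Measure.add_apply, Measure.map_apply measurable_flip hs, half s hs,
      half _ (measurable_flip hs), ← Measure.map_apply measurable_flip hs, hρ, ← add_mul,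
      ENNReal.inv_two_add_inv_two, one_mul]
  · rw [_root_.add_apply, Kernel.map_apply _ measurable_antipode,
      Measure.map_add _ _ measurable_antipode, Measure.map_map measurable_antipode
      measurable_antipode]
    have : antipode ∘ antipode = id := by ext x; simp
    rw [this, Measure.map_id, add_comm]

/-- A signed measure with a density disintegrates along with its reference measure. -/
lemma signedDisintegrates_withDensityᵥ {ρ : Measure (I × Circle)} {κ : Kernel I Circle}
    (hκ : Disintegrates ρ κ) {v : I × Circle → ℝ} (hv : Measurable v) (hvi : Integrable v ρ) :
    SignedDisintegrates (ρ.withDensityᵥ v) fun t => (κ t).withDensityᵥ fun x => v (t, x) := by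
  obtain ⟨sf, -, rfl⟩ := hκ
  have ae : ∀ᵐ t : I, Integrable (fun x => v (t, x)) (κ t) :=
    ((Measure.integrable_compProd_iff hvi.aestronglyMeasurable).1 hvi).1
  refine ⟨fun B hB => ?_, ?_, fun A B hA hB => ?_⟩
  · classical
    -- `withDensityᵥ` is zero for a nonintegrable density, so measurability needs a split at the
    -- exceptional times.
    have e : (fun t => (κ t).withDensityᵥ (fun x => v (t, x)) B) =
        fun t => if Integrable (fun x => v (t, x)) (κ t) then ∫ x in B, v (t, x) ∂(κ t) else 0 := by
      funext t
      split_ifs with h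
      · rw [withDensityᵥ_apply h hB]
      · simp [Measure.withDensityᵥ, h]
    rw [e]
    refine Measurable.ite (measurableSet_kernel_integrable
      (f := fun t x => v (t, x)) hv.stronglyMeasurable) ?_ measurable_const
    have := (hv.stronglyMeasurable.integral_kernel_prod_right (κ := κ.restrict hB)
      (f := fun t x => v (t, x))).measurable
    simpa [Kernel.restrict_apply] using this
  · refine lt_of_le_of_lt (lintegral_mono fun t => ?_)
      (by simpa [Measure.lintegral_compProd hv.enorm] using hvi.2.lt_top :
        ∫⁻ t : I, ∫⁻ x, ‖v (t, x)‖ₑ ∂(κ t) < ∞)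
    by_cases h : Integrable (fun x => v (t, x)) (κ t)
    · rw [SignedMeasure.totalVariation_eq_variation, Measure.variation_withDensityᵥ h]
      simp
    · simp [Measure.withDensityᵥ, h, SignedMeasure.totalVariation_zero]
  · rw [withDensityᵥ_apply hvi (hA.prod hB), Measure.setIntegral_compProd hA hB hvi.integrableOn]
    refine integral_congr_ae (ae_restrict_of_ae ?_)
    filter_upwards [ae] with t ht
    rw [withDensityᵥ_apply ht hB]

lemma map_antipode_withDensityᵥ {m : Measure Circle} (hm : m.map antipode = m) {v : Circle → ℝ}
    (hv : Measurable v) (hvs : ∀ x, v (antipode x) = v x) :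
    (m.withDensityᵥ v).map antipode = m.withDensityᵥ v := by
  by_cases h : Integrable v m
  · ext B hB
    rw [VectorMeasure.map_apply _ measurable_antipode hB, withDensityᵥ_apply h hB,
      withDensityᵥ_apply h (measurable_antipode hB)]
    conv_rhs => rw [← hm]
    rw [setIntegral_map hB hv.aestronglyMeasurable measurable_antipode.aemeasurable]
    simp [hvs]
  · simp [Measure.withDensityᵥ, h]

/-- The integrand is odd under the antipodal map, so the integral equals its own negative. -/
lemma integral_circle_eq_zero {m : Measure Circle} (hm : m.map antipode = m) :
    ∫ x : Circle, (x : ℂ) ∂m = 0 := by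
  have h : ∫ x : Circle, (x : ℂ) ∂m = -∫ x : Circle, (x : ℂ) ∂m := by
    conv_lhs => rw [← hm]
    rw [integral_map measurable_antipode.aemeasurable
      (by fun_prop : Continuous fun x : Circle => (x : ℂ)).aestronglyMeasurable, ← integral_neg]
    simp [antipode]
  exact self_eq_neg.1 h

/-! ### Representation of symmetric functionals by symmetric measures -/

section Representation

variable {δ E : ℝ} {ρ₀ ρ₁ : Measure Circle} {R W Z : C(I × Circle, ℝ) →ₗ[ℝ] ℝ}

/-- The time marginal of an admissible triple is absolutely continuous. -/
lemma IsAdmissible.fst_absolutelyContinuous (h : IsAdmissible δ E ρ₀ ρ₁ R W Z)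
    {ρ : Measure (I × Circle)} [IsFiniteMeasure ρ] (hR : ∀ f, R f = ∫ p, f p ∂ρ)
    {g : I × Circle → ℝ} (hg : Integrable g ρ) (hZ : ∀ f, Z f = ∫ p, f p * g p ∂ρ) :
    ρ.fst ≪ volume := by
  have hC : 0 ≤ ρ₁.real univ + ∫ p, |g p| ∂ρ :=
    add_nonneg measureReal_nonneg (integral_nonneg fun p => abs_nonneg _)
  refine absolutelyContinuous_of_integral_le hC fun f hf hf0 => ?_
  set F : ℝ → ℝ := IccExtend zero_le_one f with hF
  have Fc : Continuous F := hf.Icc_extend'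
  have F0 : ∀ t, 0 ≤ F t := fun t => hf0 _
  have Ff : ∀ t : I, F t = f t := fun t => IccExtend_val _ _ t
  -- With `u' = f`, the continuity equation reads `∫ f dρ = u(1) ρ₁(𝕊¹) - ∫ u g dρ`. Since `0 ≤ u ≤
  -- u(1) = ∫ f dt`, the right side is at most `C ∫ f dt`.
  set u : ℝ → ℝ := fun t => ∫ s in (0 : ℝ)..t, F s with hu
  have hud : ∀ t, HasDerivAt u (F t) t := fun t =>
    intervalIntegral.integral_hasDerivAt_right (Fc.intervalIntegrable _ _)
      Fc.aestronglyMeasurable.stronglyMeasurableAtFilter Fc.continuousAt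
  have du : deriv u = F := funext fun t => (hud t).deriv
  have uc : ContDiff ℝ 1 u :=
    contDiff_one_iff_deriv.2 ⟨fun t => (hud t).differentiableAt, du ▸ Fc⟩
  have um : Monotone u := monotone_of_hasDerivAt_nonneg hud F0
  have u0 : u 0 = 0 := by simp [hu]
  have u1 : u 1 = ∫ t : I, f t := by
    simp only [hu, ← integral_unitInterval F, Ff]
  have key := h.continuity_time uc
  rw [hR, hZ, u0, mul_zero, sub_zero] at key
  simp only [restrictTime_apply, du, Ff] at key
  have bound : -∫ p, u p.1 * g p ∂ρ ≤ u 1 * ∫ p, |g p| ∂ρ := by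
    rw [← integral_neg, ← integral_const_mul]
    have hi := integrable_continuousMap_mul
      (restrictTime (fun p => u p.1) (uc.continuous.comp continuous_fst)) hg
    refine integral_mono hi.neg (hg.abs.const_mul _) fun p => ?_
    have h0 : 0 ≤ u p.1 := u0 ▸ um p.1.2.1
    have h1 : u p.1 ≤ u 1 := um p.1.2.2
    calc -(u p.1 * g p) ≤ |u p.1 * g p| := neg_le_abs _
      _ = u p.1 * |g p| := by rw [abs_mul, abs_of_nonneg h0]
      _ ≤ u 1 * |g p| := by gcongr
  have e : ∫ t, f t ∂ρ.fst = ∫ p, f p.1 ∂ρ :=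
    integral_map measurable_fst.aemeasurable hf.aestronglyMeasurable
  rw [e, ← u1]
  linarith

lemma map_flip_eq {ρ : Measure (I × Circle)} [IsFiniteMeasure ρ] (hR : ∀ f, R f = ∫ p, f p ∂ρ)
    (hs : ∀ f, R (flipFun f) = R f) : ρ.map flip = ρ := by
  refine ext_of_forall_integral_eq_of_IsFiniteMeasure fun f => ?_
  rw [integral_map measurable_flip.aemeasurable f.continuous.aestronglyMeasurable]
  have := hs f.toContinuousMap
  rw [hR, hR] at this
  exact this

/-- The average of a function and its reflection. -/
def symmetrize (v : I × Circle → ℝ) (p : I × Circle) : ℝ := (v p + v (flip p)) / 2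

lemma symmetrize_antipode (v : I × Circle → ℝ) (t : I) (x : Circle) :
    symmetrize v (t, antipode x) = symmetrize v (t, x) := by
  simp [symmetrize, add_comm]

lemma measurable_symmetrize {v : I × Circle → ℝ} (hv : Measurable v) : Measurable (symmetrize v) :=
  (hv.add (hv.comp measurable_flip)).div_const 2

variable {ρ : Measure (I × Circle)}

lemma integral_comp_flip (hρ : ρ.map flip = ρ) {v : I × Circle → ℝ} (hv : Measurable v) :
    ∫ p, v (flip p) ∂ρ = ∫ p, v p ∂ρ := by
  conv_rhs => rw [← hρ]
  rw [integral_map measurable_flip.aemeasurable hv.aestronglyMeasurable]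

lemma memLp_comp_flip (hρ : ρ.map flip = ρ) {v : I × Circle → ℝ} {q : ℝ≥0∞} (hv : MemLp v q ρ) :
    MemLp (fun p => v (flip p)) q ρ :=
  hv.comp_measurePreserving ⟨measurable_flip, hρ⟩

lemma memLp_symmetrize (hρ : ρ.map flip = ρ) {v : I × Circle → ℝ} {q : ℝ≥0∞} (hv : MemLp v q ρ) :
    MemLp (symmetrize v) q ρ := by
  have e : symmetrize v = fun p => 2⁻¹ * (v + fun p => v (flip p)) p := by
    funext p
    simp only [symmetrize, Pi.add_apply]
    ring
  rw [e]
  exact (hv.add (memLp_comp_flip hρ hv)).const_mul (2⁻¹ : ℝ)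

/-- Invariance of `W` and `ρ` makes `v ∘ flip` a second density of `W`, hence the average is one
too. Unlike `v`, it is invariant at every point. -/
lemma integral_mul_symmetrize [IsFiniteMeasure ρ] (hρ : ρ.map flip = ρ) {v : I × Circle → ℝ}
    (hvm : Measurable v)
    (hv : Integrable v ρ) (hW : ∀ f : C(I × Circle, ℝ), W f = ∫ p, f p * v p ∂ρ)
    (hs : ∀ f, W (flipFun f) = W f) (f : C(I × Circle, ℝ)) :
    W f = ∫ p, f p * symmetrize v p ∂ρ := by
  have h1 : W f = ∫ p, f p * v (flip p) ∂ρ := by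
    rw [← hs f, hW, ← integral_comp_flip hρ
      (v := fun p => flipFun f p * v p) ((flipFun f).measurable.mul hvm)]
    simp
  have hv' : Integrable (fun p => v (flip p)) ρ :=
    memLp_one_iff_integrable.1 (memLp_comp_flip hρ (memLp_one_iff_integrable.2 hv))
  have h2 : W f = (W f + W f) / 2 := by ring
  rw [h2]
  nth_rw 1 [hW]
  rw [h1, ← integral_add (integrable_continuousMap_mul f hv) (integrable_continuousMap_mul f hv'),
    ← integral_div]
  refine integral_congr_ae (Filter.Eventually.of_forall fun p => ?_)
  simp only [symmetrize]
  ring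

/-- Convexity of the square, as `(v, g)` and its reflection have equal energy for an invariant `ρ`.
-/
lemma energy_symmetrize_le (hρ : ρ.map flip = ρ) {v g : I × Circle → ℝ} (hvm : Measurable v)
    (hgm : Measurable g) (hv : MemLp v 2 ρ) (hg : MemLp g 2 ρ) :
    ∫ p, (symmetrize v p ^ 2 + δ ^ 2 * symmetrize g p ^ 2) / 2 ∂ρ ≤
      ∫ p, (v p ^ 2 + δ ^ 2 * g p ^ 2) / 2 ∂ρ := by
  have int : ∀ {v g : I × Circle → ℝ}, MemLp v 2 ρ → MemLp g 2 ρ →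
      Integrable (fun p => (v p ^ 2 + δ ^ 2 * g p ^ 2) / 2) ρ := fun hv hg =>
    (hv.integrable_sq.add (hg.integrable_sq.const_mul _)).div_const 2
  have i1 := int hv hg
  have i2 := int (memLp_comp_flip hρ hv) (memLp_comp_flip hρ hg)
  have e : ∫ p, (v p ^ 2 + δ ^ 2 * g p ^ 2) / 2 ∂ρ =
      ∫ p, ((v p ^ 2 + δ ^ 2 * g p ^ 2) / 2 +
        (v (flip p) ^ 2 + δ ^ 2 * g (flip p) ^ 2) / 2) / 2 ∂ρ := by
    rw [integral_div 2 fun p => (v p ^ 2 + δ ^ 2 * g p ^ 2) / 2 +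
      (v (flip p) ^ 2 + δ ^ 2 * g (flip p) ^ 2) / 2, integral_add i1 i2, integral_comp_flip hρ
      (v := fun p => (v p ^ 2 + δ ^ 2 * g p ^ 2) / 2) (by fun_prop)]
    ring
  rw [e]
  refine integral_mono (int (memLp_symmetrize hρ hv) (memLp_symmetrize hρ hg))
    ((i1.add i2).div_const 2) fun p => ?_
  simp only [symmetrize]
  nlinarith [sq_nonneg (v p - v (flip p)), mul_nonneg (sq_nonneg δ) (sq_nonneg (g p - g (flip p)))]

/-- The energy of a triple with densities with respect to its first component. -/
lemma energy_withDensityᵥ (δ : ℝ) (μ : Path) {v g : I × Circle → ℝ}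
    (hv : Integrable v μ.ρ) (hg : Integrable g μ.ρ)
    (hω : μ.ω = (μ.ρ : Measure (I × Circle)).withDensityᵥ v)
    (hζ : μ.ζ = (μ.ρ : Measure (I × Circle)).withDensityᵥ g) :
    energy δ μ = ∫⁻ p, ENNReal.ofReal ((v p ^ 2 + δ ^ 2 * g p ^ 2) / 2) ∂(μ.ρ : Measure _) := by
  have ac : ∀ {w : I × Circle → ℝ}, Integrable w μ.ρ →
      SignedMeasure.totalVariation ((μ.ρ : Measure (I × Circle)).withDensityᵥ w) ≪ μ.ρ := fun hw => by
    rw [SignedMeasure.totalVariation_eq_variation, Measure.variation_withDensityᵥ hw]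
    exact withDensity_absolutelyContinuous _ _
  have rn : ∀ {w : I × Circle → ℝ}, Integrable w μ.ρ →
      w =ᵐ[(μ.ρ : Measure (I × Circle))]
        SignedMeasure.rnDeriv ((μ.ρ : Measure (I × Circle)).withDensityᵥ w) μ.ρ := fun hw =>
    SignedMeasure.eq_rnDeriv 0 _ hw VectorMeasure.MutuallySingular.zero_left (zero_add _).symm
  -- Taking `ρ` itself as dominating measure makes `r = 1` almost everywhere.
  rw [← energyWrt_eq_energy δ μ μ.ρ Measure.AbsolutelyContinuous.rfl (hω ▸ ac hv) (hζ ▸ ac hg)]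
  refine lintegral_congr_ae ?_
  filter_upwards [rn hv, rn hg, Measure.rnDeriv_self (μ.ρ : Measure (I × Circle))] with p h1 h2 h3
  rw [hω, hζ, ← h1, ← h2, h3]
  simp [cost]

end Representation

/-- `ρt`, `ωt` and `ζt` disintegrate the triple `μ` in time and are invariant under the antipodal
map. -/
structure IsSymmetricDisintegration (μ : Path) (ρt : Kernel I Circle)
    (ωt ζt : I → SignedMeasure Circle) : Prop where
  density : Disintegrates μ.ρ ρt
  momentum : SignedDisintegrates μ.ω ωt
  source : SignedDisintegrates μ.ζ ζt
  density_map : ∀ t, (ρt t).map antipode = ρt t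
  momentum_map : ∀ t, (ωt t).map antipode = ωt t
  source_map : ∀ t, (ζt t).map antipode = ζt t

/-- A symmetric admissible triple of functionals is represented by a symmetric triple of
measures. -/
lemma exists_path_of_isAdmissible {δ E : ℝ} (hδ : 0 < δ) {ρ₀ ρ₁ : Measure Circle}
    {R W Z : C(I × Circle, ℝ) →ₗ[ℝ] ℝ} (h : IsAdmissible δ E ρ₀ ρ₁ R W Z)
    (hRs : ∀ f, R (flipFun f) = R f) (hWs : ∀ f, W (flipFun f) = W f)
    (hZs : ∀ f, Z (flipFun f) = Z f) :
    ∃ μ ∈ CE ρ₀ ρ₁, energy δ μ ≤ ENNReal.ofReal E ∧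
      ∃ ρt ωt ζt, IsSymmetricDisintegration μ ρt ωt ζt := by
  obtain ⟨ρ, hfin, hR⟩ := exists_measure_of_nonneg R h.nonneg
  obtain ⟨v, g, hvm, hgm, hv, hg, hW, hZ, hE⟩ := exists_densities hδ ρ W Z (E := E) fun b c => by
    have := h.young b c
    rwa [map_add, map_smul, ← hR, ← hR, smul_eq_mul] at this
  have hR' : ∀ f, R f = ∫ p, f p ∂ρ := fun f => (hR f).symm
  have hρ := map_flip_eq hR' hRs
  have hvi := hv.integrable one_le_two
  have hgi := hg.integrable one_le_two
  have hac := h.fst_absolutelyContinuous hR' hgi hZ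
  obtain ⟨κ, hκ, hκs⟩ := exists_symmetric_disintegration ρ hρ hac
  have hWv := integral_mul_symmetrize hρ hvm hvi hW hWs
  have hZg := integral_mul_symmetrize hρ hgm hgi hZ hZs
  have hE' := (energy_symmetrize_le (δ := δ) hρ hvm hgm hv hg).trans hE
  have hsv := memLp_symmetrize hρ hv
  have hsg := memLp_symmetrize hρ hg
  have hsvi := hsv.integrable one_le_two
  have hsgi := hsg.integrable one_le_two
  have mv := measurable_symmetrize hvm
  have mg := measurable_symmetrize hgm
  let μ : Path := ⟨⟨ρ, hfin⟩, ρ.withDensityᵥ (symmetrize v), ρ.withDensityᵥ (symmetrize g)⟩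
  refine ⟨μ, fun φ hφ => ?_, ?_, κ, _, _, hκ, signedDisintegrates_withDensityᵥ hκ mv hsvi,
    signedDisintegrates_withDensityᵥ hκ mg hsgi, hκs,
    fun t => map_antipode_withDensityᵥ (hκs t) (by fun_prop) fun x => symmetrize_antipode v t x,
    fun t => map_antipode_withDensityᵥ (hκs t) (by fun_prop) fun x => symmetrize_antipode g t x⟩
  · rw [← h.continuity φ hφ, hR', hWv, hZg, ← integral_withDensityᵥ_continuousMap hsvi,
      ← integral_withDensityᵥ_continuousMap hsgi]
    rfl
  · rw [energy_withDensityᵥ δ μ hsvi hsgi rfl rfl]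
    change ∫⁻ p, ENNReal.ofReal ((symmetrize v p ^ 2 + δ ^ 2 * symmetrize g p ^ 2) / 2) ∂ρ ≤ _
    have hi : Integrable (fun p => (symmetrize v p ^ 2 + δ ^ 2 * symmetrize g p ^ 2) / 2) ρ :=
      (hsv.integrable_sq.add (hsg.integrable_sq.const_mul _)).div_const 2
    rw [← ofReal_integral_eq_lintegral_ofReal hi
      (Filter.Eventually.of_forall fun p => by simp only [Pi.zero_apply]; positivity)]
    exact ENNReal.ofReal_le_ofReal hE'

/-! ### Attainment and conclusion -/

/-- The infimum of the admissible energies is attained. -/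
lemma exists_least_admissible {δ : ℝ} (hδ : 0 < δ) (ρ₀ ρ₁ : Measure Circle) [IsFiniteMeasure ρ₀]
    [IsFiniteMeasure ρ₁] :
    ∃ E, IsLeast {E | ∃ R W Z, IsAdmissible δ E ρ₀ ρ₁ R W Z} E := by
  set S := {E | ∃ R W Z, IsAdmissible δ E ρ₀ ρ₁ R W Z}
  have hne : S.Nonempty := exists_admissible hδ ρ₀ ρ₁
  have hbdd : BddBelow S := ⟨0, by rintro E ⟨R, W, Z, h⟩; exact h.energy_nonneg⟩
  obtain ⟨u, -, hu, huS⟩ := exists_seq_tendsto_sInf hne hbdd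
  exact ⟨sInf S, exists_admissible_of_tendsto hδ hu huS, fun E hE => csInf_le hbdd hE⟩

end WFR

end

theorem lemma5p1 (δ : ℝ) (hδ : 0 < δ)
    (ρ₀ ρ₁ : Measure Circle) [IsFiniteMeasure ρ₀] [IsFiniteMeasure ρ₁]
    (h₀ : ρ₀.map WFR.antipode = ρ₀) (h₁ : ρ₁.map WFR.antipode = ρ₁) :
    ∃ μ : WFR.Path, WFR.IsMinimizer δ ρ₀ ρ₁ μ ∧
      ∃ (ρt : Kernel I Circle) (ωt ζt : I → SignedMeasure Circle),
        WFR.Disintegrates μ.ρ ρt ∧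
        WFR.SignedDisintegrates μ.ω ωt ∧
        WFR.SignedDisintegrates μ.ζ ζt ∧
        (∀ᵐ t : I, (ρt t).map WFR.antipode = ρt t ∧
          (ωt t).map WFR.antipode = ωt t ∧
          (ζt t).map WFR.antipode = ζt t) ∧
        (∀ᵐ t : I, ∫ x : Circle, (x : ℂ) ∂(ρt t) = 0) := by
  obtain ⟨E, ⟨R, W, Z, hE⟩, hmin⟩ := WFR.exists_least_admissible hδ ρ₀ ρ₁
  obtain ⟨R, W, Z, h, hR, hW, hZ⟩ := WFR.exists_symmetric_admissible hE h₀ h₁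
  obtain ⟨μ, hμ, hμE, ρt, ωt, ζt, hd⟩ := WFR.exists_path_of_isAdmissible hδ h hR hW hZ
  refine ⟨μ, ⟨hμ, le_antisymm ?_ (iInf₂_le μ hμ)⟩, ρt, ωt, ζt, hd.density, hd.momentum, hd.source,
    .of_forall fun t => ⟨hd.density_map t, hd.momentum_map t, hd.source_map t⟩,
    .of_forall fun t => WFR.integral_circle_eq_zero (hd.density_map t)⟩
  refine le_iInf₂ fun μ' hμ' => hμE.trans ?_
  -- A competitor of finite energy is admissible at that energy, which is therefore at least the
  -- minimum `E`.
  by_cases hfin : WFR.energy δ μ' = ∞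
  · simp [hfin]
  · exact ENNReal.ofReal_le_of_le_toReal (hmin (WFR.exists_admissible_of_mem_CE hδ hμ' hfin))
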